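/- Let $K\ge 1$, let $\mathbf H_k\in\mathbb C^{n_k\times N_t}$ for $k=1,\dots,K$, let $P\in\mathbb R$ and $\mu>0$. For tuples $\bar{\mathbf S}=(\bar{\mathbf S}_1,\dots,\bar{\mathbf S}_K)$ of Hermitian matrices $\bar{\mathbf S}_k\in\mathbb C^{n_k\times n_k}$ with $\bar{\mathbf S}_k\succeq 0$ for all $k$ (written $\bar{\mathbf S}\succeq 0$), put $$\mathcal L(\mu,\bar{\mathbf S})=\ln\Bigl|\mathbf I+\sum_{k=1}^K\mathbf H_k^{\mathsf H}\bar{\mathbf S}_k\mathbf H_k\Bigr|-\mu\Bigl(\sum_{k=1}^K\operatorname{tr}\bar{\mathbf S}_k-P\Bigr),\qquad \|\bar{\mathbf S}\|=\Bigl(\sum_{k=1}^K\|\bar{\mathbf S}_k\|_F^2\Bigr)^{1/2}.$$ Let $\bar{\mathbf S}^{(0)}\succeq 0$, and let $(\bar{\mathbf S}^{(n)})_{n\ge 0}$ be generated by cyclic block coordinate maximization: given $\bar{\mathbf S}^{(n)}$, the blocks are updated in the order $k=1,\dots,K$ by $$\bar{\mathbf S}_k^{(n+1)}=\mathbf V\operatorname{diag}\Bigl(\bigl(\tfrac1\mu-\tfrac1{\sigma_1}\bigr)_+,\dots,\bigl(\tfrac1\mu-\tfrac1{\sigma_r}\bigr)_+\Bigr)\mathbf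 V^{\mathsf H},$$ where $\mathbf H_k\bar{\mathbf H}_k^{-1}\mathbf H_k^{\mathsf H}=\mathbf V\operatorname{diag}(\sigma_1,\dots,\sigma_r)\mathbf V^{\mathsf H}$ is a compact eigenvalue decomposition ($\mathbf V^{\mathsf H}\mathbf V=\mathbf I$ and $\sigma_1,\dots,\sigma_r>0$) and $$\bar{\mathbf H}_k=\mathbf I+\sum_{j<k}\mathbf H_j^{\mathsf H}\bar{\mathbf S}_j^{(n+1)}\mathbf H_j+\sum_{j>k}\mathbf H_j^{\mathsf H}\bar{\mathbf S}_j^{(n)}\mathbf H_j .$$ Then the maxima $$\mathcal L^*_\mu=\max_{\bar{\mathbf S}\succeq 0}\mathcal L(\mu,\bar{\mathbf S}),\qquad R=\max_{\bar{\mathbf S}\succeq 0}\bigl\{\|\bar{\mathbf S}-\bar{\mathbf S}^{(0)}\| : \mathcal L(\mu,\bar{\mathbf S})\ge\mathcal L(\mu,\bar{\mathbf S}^{(0)})\bigr\}$$ exist, and with $M=\max_{1\le k\le K}\lambda_{\max}^2(\mathbf H_k\mathbf H_k^{\mathsf H})$ and $$c=\max\Bigl(\frac{2}{MK^2R^2}-2,\;2,\;\mathcal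 L^*_\mu-\mathcal L(\mu,\bar{\mathbf S}^{(1)})\Bigr)$$ (where the first entry is omitted if $MR=0$) we have $$\mathcal L^*_\mu-\mathcal L(\mu,\bar{\mathbf S}^{(n)})\le 2cMK^2R^2\,\frac1n\qquad\text{for all } n\ge 1 .$$ -/

import Mathlib

open Matrix
open scoped ComplexOrder

noncomputable section

namespace MacSumRate

/-- A tuple of square complex matrices, the `k`-th one of size `d k × d k`. -/
abbrev Blocks {K : ℕ} (d : Fin K → ℕ) : Type :=
  (k : Fin K) → Matrix (Fin (d k)) (Fin (d k)) ℂ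

/-- The feasible set: every block is Hermitian positive semidefinite. -/
def psdBlocks {K : ℕ} (d : Fin K → ℕ) : Set (Blocks d) :=
  {S | ∀ k, (S k).PosSemidef}

/-- The partial Lagrangian `ln |I + ∑ₖ Hₖᴴ Sₖ Hₖ| - μ (∑ₖ tr Sₖ - P)`. For Hermitian blocks the
determinant and the traces are real, so that taking real parts loses nothing. -/
def lagrangian {K N : ℕ} {d : Fin K → ℕ} (H : (k : Fin K) → Matrix (Fin (d k)) (Fin N) ℂ)
    (P μ : ℝ) (S : Blocks d) : ℝ :=
  Real.log ((1 + ∑ k, (H k)ᴴ * S k * H k).det).re - μ * (∑ k, ((S k).trace).re - P)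

/-- The values of the Lagrangian on the feasible set. -/
def lagrangianValues {K N : ℕ} {d : Fin K → ℕ}
    (H : (k : Fin K) → Matrix (Fin (d k)) (Fin N) ℂ) (P μ : ℝ) : Set ℝ :=
  lagrangian H P μ '' psdBlocks d

/-- The optimal value of the maximization of the Lagrangian over the feasible set. -/
def optValue {K N : ℕ} {d : Fin K → ℕ} (H : (k : Fin K) → Matrix (Fin (d k)) (Fin N) ℂ)
    (P μ : ℝ) : ℝ :=
  sSup (lagrangianValues H P μ)

/-- The interference-plus-noise matrix `I + ∑_{j ≠ k} Hⱼᴴ Sⱼ Hⱼ` seen by block `k`. -/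
def hBar {K N : ℕ} {d : Fin K → ℕ} (H : (k : Fin K) → Matrix (Fin (d k)) (Fin N) ℂ)
    (S : Blocks d) (k : Fin K) : Matrix (Fin N) (Fin N) ℂ :=
  1 + ∑ j ∈ Finset.univ.erase k, (H j)ᴴ * S j * H j

/-- `S = V diag((1/μ - 1/σᵢ)₊) Vᴴ` for a compact eigenvalue decomposition `A = V diag(σᵢ) Vᴴ`,
where `V` has orthonormal columns and all `σᵢ` are positive (so `r` is the rank of `A`). -/
def IsWaterFilling {m : ℕ} (μ : ℝ) (A S : Matrix (Fin m) (Fin m) ℂ) : Prop :=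
  ∃ (r : ℕ) (V : Matrix (Fin m) (Fin r) ℂ) (σ : Fin r → ℝ),
    Vᴴ * V = 1 ∧ (∀ i, 0 < σ i) ∧
    A = V * diagonal (fun i => (σ i : ℂ)) * Vᴴ ∧
    S = V * diagonal (fun i => ((max (1 / μ - 1 / σ i) 0 : ℝ) : ℂ)) * Vᴴ

/-- The iterates of cyclic block coordinate maximization: in sweep `n + 1` the blocks are updated
one after the other, block `k` by water-filling against the already updated blocks `j < k` and the
old blocks `j > k`. -/
def IsCBCM {K N : ℕ} {d : Fin K → ℕ} (H : (k : Fin K) → Matrix (Fin (d k)) (Fin N) ℂ)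
    (μ : ℝ) (S : ℕ → Blocks d) : Prop :=
  ∀ (n : ℕ) (k : Fin K),
    IsWaterFilling μ
      (H k * (hBar H (fun j => if j < k then S (n + 1) j else S n j) k)⁻¹ * (H k)ᴴ)
      (S (n + 1) k)

/-- The largest eigenvalue of `A Aᴴ`. -/
def lamMax {m N : ℕ} (A : Matrix (Fin m) (Fin N) ℂ) : ℝ :=
  ⨆ i, (isHermitian_mul_conjTranspose_self A).eigenvalues i

/-- `M = maxₖ λ_max(Hₖ Hₖᴴ)²`. -/
def lipConst {K N : ℕ} {d : Fin K → ℕ} (H : (k : Fin K) → Matrix (Fin (d k)) (Fin N) ℂ) : ℝ :=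
  ⨆ k, (lamMax (H k)) ^ 2

/-- The distance of two tuples in the Frobenius norm. -/
def frobDist {K : ℕ} {d : Fin K → ℕ} (S T : Blocks d) : ℝ :=
  √(∑ k, ∑ i, ∑ j, ‖S k i j - T k i j‖ ^ 2)

/-- The distances to `S₀` of the points of the feasible superlevel set of `S₀`. -/
def levelDistances {K N : ℕ} {d : Fin K → ℕ}
    (H : (k : Fin K) → Matrix (Fin (d k)) (Fin N) ℂ) (P μ : ℝ) (S₀ : Blocks d) : Set ℝ :=
  (fun S => frobDist S S₀) '' {S ∈ psdBlocks d | lagrangian H P μ S₀ ≤ lagrangian H P μ S}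

/-- The radius of the feasible superlevel set of `S₀`. -/
def levelRadius {K N : ℕ} {d : Fin K → ℕ} (H : (k : Fin K) → Matrix (Fin (d k)) (Fin N) ℂ)
    (P μ : ℝ) (S₀ : Blocks d) : ℝ :=
  sSup (levelDistances H P μ S₀)

/-- The constant `max (2 / (M K² R²) - 2, 2, gap₁)`. When `M K² R² = 0` the quotient is read as
`0`, so that the first entry plays no role. -/
def rateConst (M : ℝ) (K : ℕ) (R gap₁ : ℝ) : ℝ :=
  max (max (2 / (M * (K : ℝ) ^ 2 * R ^ 2) - 2) 2) gap₁

end MacSumRate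

end

noncomputable section

/-! All progress is measured by the inverse covariances `Y = X⁻¹`, `X = I + ∑ Hₖᴴ Sₖ Hₖ`, because
the gradient of `log det` in block `k` is `Hₖ Y Hₖᴴ`. The key inequality `frob_sq_inv_sub_inv_le` is
strong concavity in this form: for `X, X' ≥ I` the tangent at `X'` exceeds `log det` at `X` by at
least `‖X'⁻¹ - X⁻¹‖² / 2`. It also shows that inversion is nonexpansive above `I`.

Water-filling satisfies the KKT conditions of its block, so each update raises the Lagrangian by at
least `δₖ² / 2`, with `δₖ` the change of `Y`. At the end of a sweep the block-`k` gradient differs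
from the one at which block `k` was optimal only through the later steps. Concavity therefore bounds
the gap by `√M ∑ₖ (∑_{j>k} δⱼ) ‖Uₖ - Tₖ‖`, where `U` is a maximizer and `T` the new iterate
(`IsSweep.lagrangian_sub_le`).

Iterates and maximizer lie within `R` of the start, hence within `2R` of each other. Cauchy-Schwarz
and the ascent bound turn this into `xₙ₊₁² ≤ 4 M R² K (K - 1) (xₙ - xₙ₊₁)` for the gaps `xₙ`, and
`gap_le_of_recursion` solves it: `xₙ₊₁ (n + K) ≤ 4 M R² K²`. The maxima exist because the linear
penalty dominates `log det`, which makes superlevel sets compact. -/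

namespace MacSumRate

/-! ### Frobenius norm and trace inner product -/

section Frobenius

variable {m n : Type*} [Fintype m] [Fintype n]

/-- The Frobenius norm of a complex matrix. -/
def frob (A : Matrix m n ℂ) : ℝ :=
  √(∑ i, ∑ j, ‖A i j‖ ^ 2)

/-- The entries of a matrix as a vector of the Euclidean space. -/
def entries (A : Matrix m n ℂ) : EuclideanSpace ℂ (m × n) :=
  WithLp.toLp 2 fun p => A p.1 p.2

lemma norm_entries (A : Matrix m n ℂ) : ‖entries A‖ = frob A := by
  simp [entries, frob, EuclideanSpace.norm_eq, Fintype.sum_prod_type]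

lemma entries_add {m n : Type*} (A B : Matrix m n ℂ) :
    entries (A + B) = entries A + entries B := rfl

lemma frob_nonneg (A : Matrix m n ℂ) : 0 ≤ frob A := Real.sqrt_nonneg _

lemma frob_sq (A : Matrix m n ℂ) : frob A ^ 2 = ∑ i, ∑ j, ‖A i j‖ ^ 2 :=
  Real.sq_sqrt (by positivity)

lemma frob_add_le (A B : Matrix m n ℂ) : frob (A + B) ≤ frob A + frob B := by
  simp only [← norm_entries, entries_add]
  exact norm_add_le _ _

lemma frob_sub_rev (A B : Matrix m n ℂ) : frob (A - B) = frob (B - A) := by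
  simp only [← norm_entries]
  exact norm_sub_rev (entries A) (entries B)

lemma frob_sum_le {ι : Type*} (s : Finset ι) (A : ι → Matrix m n ℂ) :
    frob (∑ i ∈ s, A i) ≤ ∑ i ∈ s, frob (A i) := by
  classical
  induction s using Finset.induction_on with
  | empty => simp [frob]
  | insert a s ha ih =>
    rw [Finset.sum_insert ha, Finset.sum_insert ha]
    exact (frob_add_le _ _).trans (by gcongr)

lemma inner_entries (A B : Matrix m n ℂ) :
    inner ℂ (entries A) (entries B) = (Aᴴ * B).trace := by
  rw [trace, PiLp.inner_apply, Fintype.sum_prod_type, Finset.sum_comm]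
  simp [entries, mul_apply, mul_comm]

lemma frob_sq_eq_trace (A : Matrix m n ℂ) : frob A ^ 2 = (Aᴴ * A).trace.re := by
  rw [← inner_entries, ← norm_entries]
  exact (inner_self_eq_norm_sq (𝕜 := ℂ) (entries A)).symm

lemma re_trace_conjTranspose_mul_le (A B : Matrix m n ℂ) :
    (Aᴴ * B).trace.re ≤ frob A * frob B := by
  rw [← inner_entries, ← norm_entries, ← norm_entries]
  exact re_inner_le_norm (𝕜 := ℂ) (entries A) (entries B)

lemma re_trace_mul_le {A B : Matrix m m ℂ} (hA : A.IsHermitian) :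
    (A * B).trace.re ≤ frob A * frob B := by
  simpa only [hA.eq] using re_trace_conjTranspose_mul_le A B

end Frobenius

/-! ### Loewner order, trace inequalities and simultaneous diagonalization -/

section Trace

variable {n : Type*} [Fintype n] [DecidableEq n]

open scoped MatrixOrder in
lemma exists_eq_conjTranspose_mul_self {A : Matrix n n ℂ} (hA : A.PosSemidef) :
    ∃ B : Matrix n n ℂ, A = Bᴴ * B :=
  CStarAlgebra.nonneg_iff_eq_star_mul_self.mp hA.nonneg

lemma re_trace_mul_nonneg {A B : Matrix n n ℂ} (hA : A.PosSemidef) (hB : B.PosSemidef) :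
    0 ≤ (A * B).trace.re := by
  obtain ⟨C, rfl⟩ := exists_eq_conjTranspose_mul_self hA
  rw [Matrix.mul_assoc, trace_mul_comm, Matrix.mul_assoc, ← Matrix.mul_assoc]
  exact (Complex.nonneg_iff.mp (hB.mul_mul_conjTranspose_same C).trace_nonneg).1

lemma re_trace_mul_le_mul {A B C : Matrix n n ℂ} (hA : A.PosSemidef) (h : (C - B).PosSemidef) :
    (A * B).trace.re ≤ (A * C).trace.re := by
  have := re_trace_mul_nonneg hA h
  rw [Matrix.mul_sub, trace_sub, Complex.sub_re] at this
  linarith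

/-- Follows from `W⁻¹ - 1 = (W⁻¹ - 1) W (W⁻¹ - 1) + (1 - W)`, a sum of two positive semidefinite
terms. -/
lemma posSemidef_inv_sub_one {W : Matrix n n ℂ} (hW : W.PosDef) (h : (1 - W).PosSemidef) :
    (W⁻¹ - 1).PosSemidef := by
  have hu : IsUnit W.det := W.isUnit_iff_isUnit_det.mp hW.isUnit
  have hH : (W⁻¹ - 1)ᴴ = W⁻¹ - 1 := by
    rw [conjTranspose_sub, hW.inv.isHermitian.eq, conjTranspose_one]
  have key := (hW.posSemidef.conjTranspose_mul_mul_same (W⁻¹ - 1)).add h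
  rw [hH] at key
  convert key using 1
  rw [Matrix.sub_mul, Matrix.nonsing_inv_mul _ hu, Matrix.sub_mul, Matrix.one_mul, Matrix.one_mul,
    Matrix.mul_sub, Matrix.mul_nonsing_inv _ hu, Matrix.mul_one]
  abel

/-- With `Y = X⁻¹`, the identity behind this is `1 - Y = Y (X - 1) Y + (1 - Y)²`. -/
lemma posSemidef_one_sub_inv {X : Matrix n n ℂ} (hX : X.PosDef) (h : (X - 1).PosSemidef) :
    (1 - X⁻¹).PosSemidef := by
  have hu : IsUnit X.det := X.isUnit_iff_isUnit_det.mp hX.isUnit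
  have hY : (X⁻¹)ᴴ = X⁻¹ := hX.inv.isHermitian.eq
  have key := (h.conjTranspose_mul_mul_same X⁻¹).add (posSemidef_conjTranspose_mul_self (1 - X⁻¹))
  rw [conjTranspose_sub, hY, conjTranspose_one] at key
  convert key using 1
  rw [Matrix.mul_sub, Matrix.nonsing_inv_mul _ hu]
  noncomm_ring

lemma posDef_of_sub_one {n : Type*} [DecidableEq n] {X : Matrix n n ℂ}
    (h : (X - 1).PosSemidef) : X.PosDef := by
  simpa using PosDef.one.add_posSemidef h

lemma posSemidef_smul_one_sub {A : Matrix n n ℂ} (hA : A.IsHermitian) {l : ℝ}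
    (hl : ∀ i, hA.eigenvalues i ≤ l) : ((l : ℂ) • (1 : Matrix n n ℂ) - A).PosSemidef := by
  set U : Matrix n n ℂ := (hA.eigenvectorUnitary).1
  have hU : U * Uᴴ = 1 := Unitary.coe_mul_star_self hA.eigenvectorUnitary
  have hs : A = U * diagonal (fun i => (hA.eigenvalues i : ℂ)) * Uᴴ := by
    conv_lhs => rw [hA.spectral_theorem]
    rfl
  have hd : (diagonal fun i => ((l - hA.eigenvalues i : ℝ) : ℂ)).PosSemidef := by
    rw [posSemidef_diagonal_iff]
    intro i
    exact_mod_cast sub_nonneg.mpr (hl i)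
  convert hd.mul_mul_conjTranspose_same U using 1
  have : (diagonal fun i => ((l - hA.eigenvalues i : ℝ) : ℂ)) =
      (l : ℂ) • (1 : Matrix n n ℂ) - diagonal (fun i => (hA.eigenvalues i : ℂ)) := by
    rw [smul_one_eq_diagonal, diagonal_sub]
    simp
  rw [this, Matrix.mul_sub, Matrix.sub_mul, ← hs]
  simp [hU]

/-- Two positive definite matrices are simultaneously congruent to `1` and a diagonal matrix. -/
lemma exists_simultaneous_congruence {Y Z : Matrix n n ℂ} (hY : Y.PosDef) (hZ : Z.PosDef) :
    ∃ (C : Matrix n n ℂ) (t : n → ℝ), IsUnit C ∧ (∀ i, 0 < t i) ∧ Y = C * Cᴴ ∧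
      Z = C * diagonal (fun i => (t i : ℂ)) * Cᴴ := by
  obtain ⟨B, hB⟩ := exists_eq_conjTranspose_mul_self hY.posSemidef
  have hBu : IsUnit B := by
    have := hY.isUnit
    rw [hB, Matrix.isUnit_iff_isUnit_det, det_mul] at this
    exact B.isUnit_iff_isUnit_det.mpr (isUnit_of_mul_isUnit_right this)
  have hBd : IsUnit B.det := B.isUnit_iff_isUnit_det.mp hBu
  have hBd' : IsUnit (Bᴴ).det := by rw [det_conjTranspose]; exact hBd.star
  have hT : ((B⁻¹)ᴴ * Z * B⁻¹).PosDef :=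
    hZ.conjTranspose_mul_mul_same (Matrix.mulVec_injective_of_isUnit
      (Matrix.isUnit_nonsing_inv_iff.mpr hBu))
  set U : Matrix n n ℂ := (hT.isHermitian.eigenvectorUnitary).1
  have hU : U * Uᴴ = 1 := Unitary.coe_mul_star_self hT.isHermitian.eigenvectorUnitary
  have hs : (B⁻¹)ᴴ * Z * B⁻¹ =
      U * diagonal (fun i => (hT.isHermitian.eigenvalues i : ℂ)) * Uᴴ := by
    conv_lhs => rw [hT.isHermitian.spectral_theorem]
    rfl
  -- With `Y = Bᴴ B`, the congruence by `B⁻¹` sends `Y` to `1`; the unitary `U` then diagonalizes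
  -- the image of `Z` without disturbing `1`.
  refine ⟨Bᴴ * U, hT.isHermitian.eigenvalues, ?_, hT.eigenvalues_pos, ?_, ?_⟩
  · exact ((Matrix.isUnit_iff_isUnit_det _).mpr hBd').mul (IsUnit.of_mul_eq_one _ hU)
  · rw [conjTranspose_mul, conjTranspose_conjTranspose, Matrix.mul_assoc, ← Matrix.mul_assoc U, hU,
      Matrix.one_mul, hB]
  · rw [conjTranspose_mul, conjTranspose_conjTranspose]
    have : Bᴴ * U * diagonal (fun i => (hT.isHermitian.eigenvalues i : ℂ)) * (Uᴴ * B) =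
        Bᴴ * ((B⁻¹)ᴴ * Z * B⁻¹) * B := by
      refine Eq.trans ?_ (congrArg (fun M => Bᴴ * M * B) hs.symm)
      simp only [Matrix.mul_assoc]
    rw [this, conjTranspose_nonsing_inv, Matrix.mul_assoc, Matrix.mul_assoc, Matrix.mul_assoc,
      Matrix.nonsing_inv_mul _ hBd, Matrix.mul_one, ← Matrix.mul_assoc,
      Matrix.mul_nonsing_inv _ hBd', Matrix.one_mul]

end Trace

/-! ### Strong concavity of `log det` in the inverse -/

section LogDet

/-- Taylor's formula with integral remainder: `t - 1 - log t = ∫₀¹ s (t - 1)² / (1 + s (t - 1)) ds`,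
and `∫₀¹ s ds = 1/2`. The integral is replaced by monotonicity of the difference `f`. The hypothesis
bounds the whole sum because only a trace is controlled, not its single terms. -/
lemma half_le_sum_sub_log {n : Type*} [Fintype n] {t : n → ℝ} (ht : ∀ i, 0 < t i) {q : ℝ}
    (hq : ∀ s ∈ Set.Icc (0 : ℝ) 1, q ≤ ∑ i, (t i - 1) ^ 2 / (1 + s * (t i - 1))) :
    q / 2 ≤ ∑ i, (t i - 1 - Real.log (t i)) := by
  have hpos : ∀ s ∈ Set.Icc (0 : ℝ) 1, ∀ i, 0 < 1 + s * (t i - 1) := by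
    intro s hs i
    rcases hs.1.eq_or_lt with rfl | h
    · simp
    · nlinarith [mul_pos h (ht i), hs.2]
  set f : ℝ → ℝ := fun s =>
    ∑ i, (s * (t i - 1) - Real.log (1 + s * (t i - 1))) - s ^ 2 * (q / 2)
  have hder : ∀ s ∈ Set.Icc (0 : ℝ) 1, HasDerivAt f
      (∑ i, ((t i - 1) - (t i - 1) / (1 + s * (t i - 1))) - 2 * s * (q / 2)) s := by
    intro s hs
    refine HasDerivAt.sub (HasDerivAt.fun_sum fun i _ => ?_) ?_
    · refine (by simpa using (hasDerivAt_id s).mul_const (t i - 1) :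
        HasDerivAt (fun s : ℝ => s * (t i - 1)) (t i - 1) s).sub ?_
      exact ((by simpa using (hasDerivAt_id s).mul_const (t i - 1) :
        HasDerivAt (fun s : ℝ => s * (t i - 1)) (t i - 1) s).const_add 1).log (hpos s hs i).ne'
    · simpa using (hasDerivAt_pow 2 s).mul_const (q / 2)
  have hmono : MonotoneOn f (Set.Icc 0 1) := by
    refine monotoneOn_of_deriv_nonneg (convex_Icc 0 1)
      (fun s hs => (hder s hs).continuousAt.continuousWithinAt)
      (fun s hs => (hder s (interior_subset hs)).differentiableAt.differentiableWithinAt)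
      fun s hs => ?_
    replace hs := interior_subset hs
    rw [(hder s hs).deriv]
    have h1 : ∑ i, ((t i - 1) - (t i - 1) / (1 + s * (t i - 1))) =
        s * ∑ i, (t i - 1) ^ 2 / (1 + s * (t i - 1)) := by
      rw [Finset.mul_sum]
      refine Finset.sum_congr rfl fun i _ => ?_
      rw [eq_comm, ← mul_div_assoc, div_eq_iff (hpos s hs i).ne', sub_mul,
        div_mul_cancel₀ _ (hpos s hs i).ne']
      ring
    rw [h1]
    nlinarith [mul_le_mul_of_nonneg_left (hq s hs) hs.1]
  have h01 := hmono (Set.left_mem_Icc.mpr zero_le_one) (Set.right_mem_Icc.mpr zero_le_one)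
    zero_le_one
  simp only [f, zero_mul, add_zero, Real.log_one, sub_zero, Finset.sum_const_zero, one_mul] at h01
  simp only [add_sub_cancel] at h01
  linarith

variable {n : Type*} [Fintype n] [DecidableEq n]

/-- Strong concavity of `log det` in terms of the inverse matrices, for matrices above `1`. -/
lemma frob_sq_inv_sub_inv_le {X X' : Matrix n n ℂ} (hX : (X - 1).PosSemidef)
    (hX' : (X' - 1).PosSemidef) :
    frob (X'⁻¹ - X⁻¹) ^ 2 / 2 ≤
      Real.log X'.det.re - Real.log X.det.re - (X'⁻¹ * (X' - X)).trace.re := by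
  have hXd := posDef_of_sub_one hX
  have hXd' := posDef_of_sub_one hX'
  obtain ⟨C, t, hCu, ht, hY, hZ⟩ := exists_simultaneous_congruence hXd.inv hXd'.inv
  have hXu : IsUnit X.det := X.isUnit_iff_isUnit_det.mp hXd.isUnit
  have hXu' : IsUnit X'.det := X'.isUnit_iff_isUnit_det.mp hXd'.isUnit
  have hCd : IsUnit C.det := C.isUnit_iff_isUnit_det.mp hCu
  have hCd' : IsUnit (Cᴴ).det := by rw [det_conjTranspose]; exact hCd.star
  have hXC : X = (Cᴴ)⁻¹ * C⁻¹ := by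
    rw [← Matrix.mul_inv_rev, ← hY, Matrix.nonsing_inv_nonsing_inv _ hXu]
  have htr : (X'⁻¹ * (X' - X)).trace.re = -∑ i, (t i - 1) := by
    have h1 : (X'⁻¹ * X).trace = ∑ i, (t i : ℂ) := by
      rw [hZ, hXC, Matrix.mul_assoc, ← Matrix.mul_assoc Cᴴ, Matrix.mul_nonsing_inv _ hCd',
        Matrix.one_mul, trace_mul_comm, ← Matrix.mul_assoc, Matrix.nonsing_inv_mul _ hCd,
        Matrix.one_mul, trace_diagonal]
    rw [Matrix.mul_sub, trace_sub, h1, Matrix.nonsing_inv_mul _ hXu', trace_one]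
    simp
  have hdet : Real.log X'.det.re - Real.log X.det.re = -∑ i, Real.log (t i) := by
    have h1 : X'⁻¹.det = X⁻¹.det * ∏ i, (t i : ℂ) := by
      rw [hZ, hY, det_mul, det_mul, det_mul, det_diagonal]; ring
    have h2 : X.det = X'.det * ((∏ i, t i : ℝ) : ℂ) := by
      have e1 := det_nonsing_inv_mul_det X hXu
      have e2 := det_nonsing_inv_mul_det X' hXu'
      push_cast
      calc X.det = X.det * (X'⁻¹.det * X'.det) := by rw [e2, mul_one]
        _ = (X⁻¹.det * X.det) * (X'.det * ∏ i, (t i : ℂ)) := by rw [h1]; ring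
        _ = _ := by rw [e1, one_mul]
    have hp : 0 < X'.det.re := (Complex.pos_iff.mp hXd'.det_pos).1
    rw [h2, Complex.re_mul_ofReal, Real.log_mul hp.ne' (Finset.prod_pos fun i _ => ht i).ne',
      Real.log_prod (fun i _ => (ht i).ne')]
    ring
  rw [htr, hdet]
  -- What remains is a lower bound on the second derivative of `-log det` along the segment `W` from
  -- `X⁻¹` to `X'⁻¹`. In the coordinates `C` it equals `tr (Δ X Δ W⁻¹)`, and both `X` and `W⁻¹` are
  -- at least `1`.
  have hgoal := half_le_sum_sub_log ht (q := frob (X'⁻¹ - X⁻¹) ^ 2) ?_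
  · rw [Finset.sum_sub_distrib] at hgoal
    linarith
  intro s hs
  set Δ := X'⁻¹ - X⁻¹ with hΔ
  have hΔh : Δᴴ = Δ := by
    rw [hΔ, conjTranspose_sub, hXd.inv.isHermitian.eq, hXd'.inv.isHermitian.eq]
  set W := ((1 - s : ℝ) : ℂ) • X⁻¹ + (s : ℂ) • X'⁻¹ with hW
  have hΔC : Δ = C * diagonal (fun i => ((t i - 1 : ℝ) : ℂ)) * Cᴴ := by
    have : (diagonal fun i => ((t i - 1 : ℝ) : ℂ)) = diagonal (fun i => (t i : ℂ)) - 1 := by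
      rw [← diagonal_one, diagonal_sub]; simp
    rw [this, Matrix.mul_sub, Matrix.sub_mul, ← hZ, Matrix.mul_one, ← hY]
  have hpos : ∀ i, 0 < 1 + s * (t i - 1) := by
    intro i
    rcases hs.1.eq_or_lt with rfl | h
    · simp
    · nlinarith [mul_pos h (ht i), hs.2]
  have hWC : W = C * diagonal (fun i => ((1 + s * (t i - 1) : ℝ) : ℂ)) * Cᴴ := by
    have : (diagonal fun i => ((1 + s * (t i - 1) : ℝ) : ℂ)) =
        ((1 - s : ℝ) : ℂ) • (1 : Matrix n n ℂ) + (s : ℂ) • diagonal (fun i => (t i : ℂ)) := by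
      rw [smul_one_eq_diagonal, ← diagonal_smul, diagonal_add]
      congr 1; funext i; simp; ring
    rw [this, Matrix.mul_add, Matrix.add_mul, Matrix.mul_smul, Matrix.smul_mul, Matrix.mul_smul,
      Matrix.smul_mul, ← hZ, Matrix.mul_one, ← hY]
  have hWd : W.PosDef := by
    rw [hWC]
    refine PosDef.mul_mul_conjTranspose_same ?_ ?_
    · rw [posDef_diagonal_iff]
      intro i
      exact_mod_cast hpos i
    · exact Matrix.vecMul_injective_of_isUnit hCu
  have hW1 : (1 - W).PosSemidef := by
    have h1 : (0 : ℂ) ≤ ((1 - s : ℝ) : ℂ) := by exact_mod_cast sub_nonneg.mpr hs.2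
    have h2 : (0 : ℂ) ≤ (s : ℂ) := by exact_mod_cast hs.1
    convert ((posSemidef_one_sub_inv hXd hX).smul h1).add
      ((posSemidef_one_sub_inv hXd' hX').smul h2) using 1
    rw [hW, smul_sub, smul_sub]
    have : (1 : Matrix n n ℂ) = ((1 - s : ℝ) : ℂ) • (1 : Matrix n n ℂ) + (s : ℂ) • 1 := by
      rw [← add_smul]; simp
    nth_rewrite 1 [this]
    abel
  have hWinv := posSemidef_inv_sub_one hWd hW1
  calc frob Δ ^ 2 = (Δ * Δ * 1).trace.re := by rw [frob_sq_eq_trace, hΔh, Matrix.mul_one]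
    _ ≤ (Δ * Δ * X).trace.re := by
        refine re_trace_mul_le_mul ?_ hX
        simpa only [hΔh] using posSemidef_conjTranspose_mul_self Δ
    _ = (Δ * X * Δ * 1).trace.re := by
        rw [Matrix.mul_one, Matrix.mul_assoc, trace_mul_comm]
    _ ≤ (Δ * X * Δ * W⁻¹).trace.re := by
        refine re_trace_mul_le_mul ?_ hWinv
        simpa only [hΔh] using hXd.posSemidef.conjTranspose_mul_mul_same Δ
    _ = ∑ i, (t i - 1) ^ 2 / (1 + s * (t i - 1)) := by
        have hWi : W⁻¹ = (Cᴴ)⁻¹ * diagonal (fun i => ((1 / (1 + s * (t i - 1)) : ℝ) : ℂ)) * C⁻¹ := by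
          refine Matrix.inv_eq_left_inv ?_
          rw [hWC]
          calc _ = (Cᴴ)⁻¹ * diagonal (fun i => ((1 / (1 + s * (t i - 1)) : ℝ) : ℂ)) * (C⁻¹ * C) *
                diagonal (fun i => ((1 + s * (t i - 1) : ℝ) : ℂ)) * Cᴴ := by
                simp only [Matrix.mul_assoc]
            _ = (Cᴴ)⁻¹ * (diagonal (fun i => ((1 / (1 + s * (t i - 1)) : ℝ) : ℂ)) *
                diagonal (fun i => ((1 + s * (t i - 1) : ℝ) : ℂ))) * Cᴴ := by
                rw [Matrix.nonsing_inv_mul _ hCd, Matrix.mul_one]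
                simp only [Matrix.mul_assoc]
            _ = 1 := by
                rw [diagonal_mul_diagonal]
                have : (fun i => ((1 / (1 + s * (t i - 1)) : ℝ) : ℂ) *
                    ((1 + s * (t i - 1) : ℝ) : ℂ)) = fun _ => 1 := by
                  funext i
                  rw [← Complex.ofReal_mul, one_div_mul_cancel (hpos i).ne', Complex.ofReal_one]
                rw [this, diagonal_one, Matrix.mul_one, Matrix.nonsing_inv_mul _ hCd']
        set u := diagonal (fun i => ((t i - 1 : ℝ) : ℂ))
        set w := diagonal (fun i => ((1 / (1 + s * (t i - 1)) : ℝ) : ℂ))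
        have : Δ * X * Δ * W⁻¹ = C * (u * u * w) * C⁻¹ := by
          rw [hWi, hΔC, hXC]
          calc _ = C * u * (Cᴴ * (Cᴴ)⁻¹) * (C⁻¹ * C) * u * (Cᴴ * (Cᴴ)⁻¹) * w * C⁻¹ := by
                simp only [Matrix.mul_assoc]
            _ = _ := by
                rw [Matrix.nonsing_inv_mul _ hCd, Matrix.mul_nonsing_inv _ hCd']
                simp only [Matrix.mul_assoc, Matrix.one_mul]
        rw [this, trace_mul_comm, ← Matrix.mul_assoc, Matrix.nonsing_inv_mul _ hCd, Matrix.one_mul,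
          diagonal_mul_diagonal, diagonal_mul_diagonal, trace_diagonal, Complex.re_sum]
        refine Finset.sum_congr rfl fun i _ => ?_
        rw [← Complex.ofReal_mul, ← Complex.ofReal_mul, Complex.ofReal_re]
        ring

/-- The first-order upper bound on the concave function `log det`. -/
lemma log_det_sub_le {X X' : Matrix n n ℂ} (hX : (X - 1).PosSemidef) (hX' : (X' - 1).PosSemidef) :
    Real.log X.det.re - Real.log X'.det.re ≤ (X'⁻¹ * (X - X')).trace.re := by
  have h := frob_sq_inv_sub_inv_le hX hX'
  rw [← neg_sub X X', Matrix.mul_neg, trace_neg, Complex.neg_re] at h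
  nlinarith [sq_nonneg (frob (X'⁻¹ - X⁻¹))]

/-- The inverse is nonexpansive on the matrices above `1`. -/
lemma frob_inv_sub_inv_le {X X' : Matrix n n ℂ} (hX : (X - 1).PosSemidef)
    (hX' : (X' - 1).PosSemidef) : frob (X'⁻¹ - X⁻¹) ≤ frob (X' - X) := by
  -- Adding the inequality to its mirror image cancels the logarithms. Cauchy-Schwarz bounds the
  -- remaining trace, and one factor of the norm divides out.
  have h1 := frob_sq_inv_sub_inv_le hX hX'
  have h2 := frob_sq_inv_sub_inv_le hX' hX
  have hsym := frob_sub_rev X⁻¹ X'⁻¹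
  have hXd := posDef_of_sub_one hX
  have hXd' := posDef_of_sub_one hX'
  have hH : (X⁻¹ - X'⁻¹).IsHermitian := hXd.inv.isHermitian.sub hXd'.inv.isHermitian
  have hcs := re_trace_mul_le (B := X' - X) hH
  rw [Matrix.sub_mul, trace_sub, Complex.sub_re] at hcs
  rw [← neg_sub X' X, Matrix.mul_neg, trace_neg, Complex.neg_re, hsym] at h2
  rw [hsym] at hcs
  rcases (frob_nonneg (X'⁻¹ - X⁻¹)).eq_or_lt with h | h
  · rw [← h]; exact frob_nonneg _
  · refine le_of_mul_le_mul_left ?_ h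
    nlinarith

end LogDet

/-! ### Operator bounds for the channel matrices -/

section Channel

variable {m N : ℕ}

lemma posSemidef_lamMax_smul_sub (H : Matrix (Fin m) (Fin N) ℂ) :
    ((lamMax H : ℂ) • (1 : Matrix (Fin m) (Fin m) ℂ) - H * Hᴴ).PosSemidef :=
  posSemidef_smul_one_sub _ fun i => le_ciSup (Set.finite_range _).bddAbove i

lemma lamMax_nonneg (H : Matrix (Fin m) (Fin N) ℂ) : 0 ≤ lamMax H :=
  Real.iSup_nonneg fun i => (posSemidef_self_mul_conjTranspose H).eigenvalues_nonneg i

lemma re_trace_mul_mul_conjTranspose_le (H : Matrix (Fin m) (Fin N) ℂ)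
    {A : Matrix (Fin m) (Fin m) ℂ} (hA : A.PosSemidef) :
    (A * (H * Hᴴ)).trace.re ≤ lamMax H * A.trace.re := by
  refine (re_trace_mul_le_mul hA (posSemidef_lamMax_smul_sub H)).trans_eq ?_
  rw [Matrix.mul_smul, trace_smul, Matrix.mul_one, smul_eq_mul, Complex.re_ofReal_mul]

/-- The squared norm is `tr (B G B G)` with `G = H Hᴴ ≤ lamMax H • 1`; each `G` is replaced by its
bound in turn. -/
lemma frob_conjTranspose_mul_mul_le (H : Matrix (Fin m) (Fin N) ℂ)
    {B : Matrix (Fin m) (Fin m) ℂ} (hB : B.IsHermitian) :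
    frob (Hᴴ * B * H) ≤ lamMax H * frob B := by
  refine le_of_sq_le_sq ?_ (mul_nonneg (lamMax_nonneg H) (frob_nonneg B))
  have hBB : (B * B).PosSemidef := by
    simpa only [hB.eq] using posSemidef_conjTranspose_mul_self B
  have hG : (B * (H * Hᴴ) * B).PosSemidef := by
    simpa only [hB.eq] using
      (posSemidef_self_mul_conjTranspose H).conjTranspose_mul_mul_same B
  calc frob (Hᴴ * B * H) ^ 2 = (Hᴴ * (B * H * Hᴴ * B * H)).trace.re := by
        rw [frob_sq_eq_trace]
        simp only [conjTranspose_mul, conjTranspose_conjTranspose, hB.eq, Matrix.mul_assoc]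
    _ = (B * (H * Hᴴ) * B * (H * Hᴴ)).trace.re := by
        rw [trace_mul_comm]
        simp only [Matrix.mul_assoc]
    _ ≤ lamMax H * (B * (H * Hᴴ) * B).trace.re := re_trace_mul_mul_conjTranspose_le H hG
    _ = lamMax H * (B * B * (H * Hᴴ)).trace.re := by
        rw [trace_mul_comm, ← Matrix.mul_assoc]
    _ ≤ lamMax H * (lamMax H * (B * B).trace.re) :=
        mul_le_mul_of_nonneg_left (re_trace_mul_mul_conjTranspose_le H hBB) (lamMax_nonneg H)
    _ = (lamMax H * frob B) ^ 2 := by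
        rw [mul_pow, frob_sq_eq_trace, hB.eq]
        ring

/-- This is the adjoint of `A ↦ Hᴴ A H`, so duality transfers the preceding bound. -/
lemma frob_mul_mul_conjTranspose_le (H : Matrix (Fin m) (Fin N) ℂ)
    {A : Matrix (Fin N) (Fin N) ℂ} (hA : A.IsHermitian) :
    frob (H * A * Hᴴ) ≤ lamMax H * frob A := by
  set B := H * A * Hᴴ with hBdef
  have hB : B.IsHermitian := isHermitian_mul_mul_conjTranspose H hA
  rcases (frob_nonneg B).eq_or_lt with h | h
  · rw [← h]; exact mul_nonneg (lamMax_nonneg H) (frob_nonneg A)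
  refine le_of_mul_le_mul_left ?_ h
  calc frob B * frob B = (A * (Hᴴ * B * H)).trace.re := by
        rw [← sq, frob_sq_eq_trace, hB.eq]
        nth_rewrite 1 [hBdef]
        rw [Matrix.mul_assoc, Matrix.mul_assoc, trace_mul_comm]
        simp only [Matrix.mul_assoc]
    _ ≤ frob A * frob (Hᴴ * B * H) := re_trace_mul_le hA
    _ ≤ frob A * (lamMax H * frob B) :=
        mul_le_mul_of_nonneg_left (frob_conjTranspose_mul_mul_le H hB) (frob_nonneg A)
    _ = frob B * (lamMax H * frob A) := by ring

variable {K : ℕ} {d : Fin K → ℕ} (H : (k : Fin K) → Matrix (Fin (d k)) (Fin N) ℂ)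

lemma lamMax_sq_le_lipConst (k : Fin K) : lamMax (H k) ^ 2 ≤ lipConst H :=
  le_ciSup (f := fun k => lamMax (H k) ^ 2) (Set.finite_range _).bddAbove k

lemma lipConst_nonneg : 0 ≤ lipConst H := Real.iSup_nonneg fun _ => sq_nonneg _

lemma lamMax_le_sqrt_lipConst (k : Fin K) : lamMax (H k) ≤ √(lipConst H) :=
  Real.le_sqrt_of_sq_le (lamMax_sq_le_lipConst H k)

end Channel

/-! ### KKT conditions of water-filling -/

section WaterFilling

variable {m r : ℕ}

/-- `V diag(f) Vᴴ` with a real diagonal. -/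
def conjDiag (V : Matrix (Fin m) (Fin r) ℂ) (f : Fin r → ℝ) : Matrix (Fin m) (Fin m) ℂ :=
  V * diagonal (fun i => (f i : ℂ)) * Vᴴ

lemma conjDiag_add (V : Matrix (Fin m) (Fin r) ℂ) (f g : Fin r → ℝ) :
    conjDiag V f + conjDiag V g = conjDiag V (fun i => f i + g i) := by
  rw [conjDiag, conjDiag, conjDiag, ← Matrix.add_mul, ← Matrix.mul_add, diagonal_add]
  simp

lemma conjDiag_mul {V : Matrix (Fin m) (Fin r) ℂ} (hV : Vᴴ * V = 1) (f g : Fin r → ℝ) :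
    conjDiag V f * conjDiag V g = conjDiag V (fun i => f i * g i) := by
  rw [conjDiag, conjDiag, conjDiag]
  calc _ = V * diagonal (fun i => (f i : ℂ)) * (Vᴴ * V) * diagonal (fun i => (g i : ℂ)) * Vᴴ := by
        simp only [Matrix.mul_assoc]
    _ = V * (diagonal (fun i => (f i : ℂ)) * diagonal (fun i => (g i : ℂ))) * Vᴴ := by
        rw [hV, Matrix.mul_one, Matrix.mul_assoc V]
    _ = _ := by rw [diagonal_mul_diagonal]; simp

lemma conjDiag_zero (V : Matrix (Fin m) (Fin r) ℂ) : conjDiag V (fun _ => 0) = 0 := by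
  simp [conjDiag]

lemma re_trace_conjDiag {V : Matrix (Fin m) (Fin r) ℂ} (hV : Vᴴ * V = 1) (f : Fin r → ℝ) :
    (conjDiag V f).trace.re = ∑ i, f i := by
  rw [conjDiag, trace_mul_comm, ← Matrix.mul_assoc, hV, Matrix.one_mul, trace_diagonal]
  simp

lemma posSemidef_conjDiag (V : Matrix (Fin m) (Fin r) ℂ) {f : Fin r → ℝ} (hf : ∀ i, 0 ≤ f i) :
    (conjDiag V f).PosSemidef := by
  refine PosSemidef.mul_mul_conjTranspose_same ?_ V
  rw [posSemidef_diagonal_iff]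
  intro i
  exact_mod_cast hf i

lemma posSemidef_one_sub_mul_conjTranspose {V : Matrix (Fin m) (Fin r) ℂ} (hV : Vᴴ * V = 1) :
    (1 - V * Vᴴ).PosSemidef := by
  have h : V * Vᴴ * (V * Vᴴ) = V * Vᴴ := by
    rw [Matrix.mul_assoc, ← Matrix.mul_assoc Vᴴ, hV, Matrix.one_mul]
  convert posSemidef_conjTranspose_mul_self (1 - V * Vᴴ) using 1
  rw [conjTranspose_sub, conjTranspose_one, conjTranspose_mul, conjTranspose_conjTranspose,
    Matrix.mul_sub, Matrix.mul_one, Matrix.sub_mul, Matrix.one_mul, h, sub_self, sub_zero]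

lemma IsWaterFilling.posSemidef {μ : ℝ} {A S : Matrix (Fin m) (Fin m) ℂ}
    (h : IsWaterFilling μ A S) : S.PosSemidef := by
  obtain ⟨r, V, σ, -, -, -, rfl⟩ := h
  exact posSemidef_conjDiag V (f := fun i => max (1 / μ - 1 / σ i) 0) fun i => le_max_right _ _

/-- The water-filling block satisfies the first-order optimality condition of the maximization of
the Lagrangian over this block. -/
lemma IsWaterFilling.re_trace_gradient_mul_le {N : ℕ} {μ : ℝ} (hμ : 0 < μ)
    {H : Matrix (Fin m) (Fin N) ℂ} {X : Matrix (Fin N) (Fin N) ℂ} (hX : X.PosDef)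
    {S T : Matrix (Fin m) (Fin m) ℂ} (h : IsWaterFilling μ (H * X⁻¹ * Hᴴ) S) (hT : T.PosSemidef) :
    ((H * (X + Hᴴ * S * H)⁻¹ * Hᴴ) * (T - S)).trace.re ≤ μ * (T - S).trace.re := by
  have hSpsd := h.posSemidef
  obtain ⟨r, V, σ, hV, hσ, hA, hS⟩ := h
  set s : Fin r → ℝ := fun i => max (1 / μ - 1 / σ i) 0
  change _ = conjDiag V σ at hA
  change S = conjDiag V s at hS
  have hs : ∀ i, 0 ≤ s i := fun i => le_max_right _ _
  have hden : ∀ i, 0 < 1 + σ i * s i := fun i => by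
    have := mul_nonneg (hσ i).le (hs i); linarith
  set e : Fin r → ℝ := fun i => σ i / (1 + σ i * s i) with he
  have hX' : (X + Hᴴ * S * H).PosDef :=
    hX.add_posSemidef (hSpsd.conjTranspose_mul_mul_same H)
  have hu : IsUnit X.det := X.isUnit_iff_isUnit_det.mp hX.isUnit
  have hu' := (Matrix.isUnit_iff_isUnit_det _).mp hX'.isUnit
  set E := H * (X + Hᴴ * S * H)⁻¹ * Hᴴ with hE
  -- A resolvent identity: it determines `E` from two matrices that are both diagonal in `V`, so `E`
  -- is diagonal in `V` too.
  have hlin : (1 + conjDiag V σ * S) * E = conjDiag V σ := by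
    rw [← hA, hE]
    calc _ = H * X⁻¹ * (X + Hᴴ * S * H) * (X + Hᴴ * S * H)⁻¹ * Hᴴ := by
          rw [Matrix.mul_add, Matrix.mul_assoc H X⁻¹ X, Matrix.nonsing_inv_mul _ hu]
          simp only [Matrix.mul_one, Matrix.add_mul, Matrix.one_mul, Matrix.mul_assoc]
      _ = _ := by
          rw [Matrix.mul_assoc (H * X⁻¹), Matrix.mul_nonsing_inv _ hu', Matrix.mul_one]
  have hEe : E = conjDiag V e := by
    set p : Fin r → ℝ := fun i => 1 / (1 + σ i * s i) - 1 with hp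
    have hinv : (1 + conjDiag V p) * (1 + conjDiag V σ * S) = 1 := by
      rw [hS, conjDiag_mul hV, Matrix.add_mul, Matrix.one_mul, Matrix.mul_add, Matrix.mul_one,
        conjDiag_mul hV, add_assoc, conjDiag_add, conjDiag_add]
      have : (fun i => σ i * s i + (p i + p i * (σ i * s i))) = fun _ => 0 := by
        funext i
        have := (hden i).ne'
        simp only [hp]
        field_simp
        ring
      rw [this, conjDiag_zero, add_zero]
    calc E = (1 + conjDiag V p) * (1 + conjDiag V σ * S) * E := by rw [hinv, Matrix.one_mul]
      _ = (1 + conjDiag V p) * conjDiag V σ := by rw [Matrix.mul_assoc, hlin]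
      _ = conjDiag V e := by
          rw [Matrix.add_mul, Matrix.one_mul, conjDiag_mul hV, conjDiag_add]
          congr 1
          funext i
          simp only [hp, he]
          ring
  -- Complementary slackness: an inactive channel has `s i = 0` and `e i = σ i ≤ μ`, an active one
  -- has `e i = μ`.
  have hcases : ∀ i, e i ≤ μ ∧ e i * s i = μ * s i := by
    intro i
    rcases le_total (1 / μ - 1 / σ i) 0 with hle | hle
    · have hs0 : s i = 0 := max_eq_right hle
      have : σ i ≤ μ := (one_div_le_one_div hμ (hσ i)).mp (by linarith)
      simp [he, hs0, this]
    · have hs1 : s i = 1 / μ - 1 / σ i := max_eq_left hle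
      have : e i = μ := by
        have := (hσ i).ne'
        have := hμ.ne'
        have h1 : 1 + σ i * s i = σ i / μ := by rw [hs1]; field_simp; ring
        simp only [he, h1]
        field_simp
      simp [this]
  -- `E` vanishes orthogonally to the range of `V`; there the summand `μ (1 - V Vᴴ)` takes over.
  have hpsd : ((μ : ℂ) • (1 : Matrix (Fin m) (Fin m) ℂ) - E).PosSemidef := by
    have h1 : (0 : ℂ) ≤ (μ : ℂ) := by exact_mod_cast hμ.le
    convert ((posSemidef_one_sub_mul_conjTranspose hV).smul h1).add
      (posSemidef_conjDiag V (f := fun i => μ - e i) fun i => sub_nonneg.mpr (hcases i).1) using 1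
    have hVV : (μ : ℂ) • (V * Vᴴ) = conjDiag V fun _ => μ := by
      simp [conjDiag, ← smul_one_eq_diagonal]
    have : conjDiag V (fun i => μ - e i) + conjDiag V e = conjDiag V fun _ => μ := by
      rw [conjDiag_add]; simp
    rw [smul_sub, hVV, ← this, hEe]
    abel
  have hTE : (E * T).trace.re ≤ μ * T.trace.re := by
    have := re_trace_mul_le_mul hT hpsd
    rw [Matrix.mul_smul, trace_smul, Matrix.mul_one, smul_eq_mul, Complex.re_ofReal_mul] at this
    rwa [trace_mul_comm]
  have hSE : (E * S).trace.re = μ * S.trace.re := by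
    rw [hEe, hS, conjDiag_mul hV, re_trace_conjDiag hV, re_trace_conjDiag hV, Finset.mul_sum]
    exact Finset.sum_congr rfl fun i _ => (hcases i).2
  rw [Matrix.mul_sub, trace_sub, trace_sub, Complex.sub_re, Complex.sub_re, hSE]
  linarith

end WaterFilling

variable {K N : ℕ} {d : Fin K → ℕ}

/-! ### Covariance matrix and gradient inequality -/

section Covariance

variable (H : (k : Fin K) → Matrix (Fin (d k)) (Fin N) ℂ)

/-- The matrix `I + ∑ₖ Hₖᴴ Sₖ Hₖ` in the Lagrangian. -/
def covariance (S : Blocks d) : Matrix (Fin N) (Fin N) ℂ :=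
  1 + ∑ k, (H k)ᴴ * S k * H k

lemma lagrangian_eq (P μ : ℝ) (S : Blocks d) : lagrangian H P μ S =
    Real.log (covariance H S).det.re - μ * (∑ k, (S k).trace.re - P) := rfl

lemma posSemidef_covariance_sub_one {S : Blocks d} (hS : S ∈ psdBlocks d) :
    (covariance H S - 1).PosSemidef := by
  rw [covariance, add_sub_cancel_left]
  exact posSemidef_sum _ fun k _ => (hS k).conjTranspose_mul_mul_same (H k)

lemma covariance_eq_hBar_add (S : Blocks d) (k : Fin K) :
    covariance H S = hBar H S k + (H k)ᴴ * S k * H k := by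
  rw [covariance, hBar, ← Finset.sum_erase_add _ _ (Finset.mem_univ k), add_assoc]

lemma posDef_hBar {S : Blocks d} (hS : S ∈ psdBlocks d) (k : Fin K) : (hBar H S k).PosDef :=
  PosDef.one.add_posSemidef
    (posSemidef_sum _ fun j _ => (hS j).conjTranspose_mul_mul_same (H j))

lemma hBar_congr {S T : Blocks d} {k : Fin K} (h : ∀ j, j ≠ k → S j = T j) :
    hBar H S k = hBar H T k := by
  rw [hBar, hBar]
  congr 1
  exact Finset.sum_congr rfl fun j hj => by rw [h j (Finset.ne_of_mem_erase hj)]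

/-- The gradient inequality of the concave Lagrangian. -/
lemma lagrangian_sub_le (P μ : ℝ) {S T : Blocks d} (hS : S ∈ psdBlocks d) (hT : T ∈ psdBlocks d) :
    lagrangian H P μ T - lagrangian H P μ S ≤
      ∑ k, ((H k * (covariance H S)⁻¹ * (H k)ᴴ * (T k - S k)).trace.re -
        μ * (T k - S k).trace.re) := by
  have h := log_det_sub_le (posSemidef_covariance_sub_one H hT) (posSemidef_covariance_sub_one H hS)
  have hdiff : covariance H T - covariance H S = ∑ k, (H k)ᴴ * (T k - S k) * H k := by
    simp only [covariance, add_sub_add_left_eq_sub, ← Finset.sum_sub_distrib, Matrix.mul_sub,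
      Matrix.sub_mul]
  rw [hdiff, Finset.mul_sum, trace_sum, Complex.re_sum] at h
  have hterm : ∀ k, ((covariance H S)⁻¹ * ((H k)ᴴ * (T k - S k) * H k)).trace =
      (H k * (covariance H S)⁻¹ * (H k)ᴴ * (T k - S k)).trace := by
    intro k
    rw [← Matrix.mul_assoc, trace_mul_comm]
    simp only [Matrix.mul_assoc]
  simp only [hterm] at h
  rw [lagrangian_eq, lagrangian_eq, Finset.sum_sub_distrib, ← Finset.mul_sum]
  simp only [trace_sub, Complex.sub_re, Finset.sum_sub_distrib]
  simp only [mul_sub] at h ⊢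
  linarith

end Covariance

/-! ### Ascent and suboptimality over one sweep -/

section Sweep

/-- The point reached after `k` of the blocks of `S` have been replaced by those of `T`. -/
def partialUpdate (S T : Blocks d) (k : ℕ) : Blocks d :=
  fun j => if (j : ℕ) < k then T j else S j

lemma partialUpdate_zero (S T : Blocks d) : partialUpdate S T 0 = S := by
  funext j; simp [partialUpdate]

lemma partialUpdate_last (S T : Blocks d) : partialUpdate S T K = T := by
  funext j; simp [partialUpdate]

lemma partialUpdate_mem {S T : Blocks d} (hS : S ∈ psdBlocks d) (hT : T ∈ psdBlocks d) (k : ℕ) :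
    partialUpdate S T k ∈ psdBlocks d := by
  intro j
  unfold partialUpdate
  split_ifs
  exacts [hT j, hS j]

lemma partialUpdate_self (S T : Blocks d) (k : Fin K) : partialUpdate S T k k = S k := by
  simp [partialUpdate]

lemma partialUpdate_succ_self (S T : Blocks d) (k : Fin K) :
    partialUpdate S T (k + 1) k = T k := by
  simp [partialUpdate]

lemma partialUpdate_succ_of_ne (S T : Blocks d) {k j : Fin K} (h : j ≠ k) :
    partialUpdate S T (k + 1) j = partialUpdate S T k j := by
  have : (j : ℕ) ≠ k := fun e => h (Fin.ext e)
  have : (j : ℕ) < k + 1 ↔ (j : ℕ) < k := by omega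
  simp only [partialUpdate, this]

/-- `T` arises from `S` by one sweep of block coordinate maximization. -/
def IsSweep (H : (k : Fin K) → Matrix (Fin (d k)) (Fin N) ℂ) (μ : ℝ) (S T : Blocks d) : Prop :=
  ∀ k : Fin K, IsWaterFilling μ (H k * (hBar H (partialUpdate S T k) k)⁻¹ * (H k)ᴴ) (T k)

lemma IsCBCM.isSweep {H : (k : Fin K) → Matrix (Fin (d k)) (Fin N) ℂ} {μ : ℝ} {S : ℕ → Blocks d}
    (h : IsCBCM H μ S) (n : ℕ) : IsSweep H μ (S n) (S (n + 1)) :=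
  fun k => h n k

variable (H : (k : Fin K) → Matrix (Fin (d k)) (Fin N) ℂ)

lemma covariance_partialUpdate (S T : Blocks d) (k : Fin K) :
    covariance H (partialUpdate S T k) =
      hBar H (partialUpdate S T k) k + (H k)ᴴ * S k * H k := by
  rw [covariance_eq_hBar_add H _ k, partialUpdate_self]

lemma covariance_partialUpdate_succ (S T : Blocks d) (k : Fin K) :
    covariance H (partialUpdate S T (k + 1)) =
      hBar H (partialUpdate S T k) k + (H k)ᴴ * T k * H k := by
  rw [covariance_eq_hBar_add H _ k, partialUpdate_succ_self,
    hBar_congr H fun j hj => partialUpdate_succ_of_ne S T hj]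

/-- The change of the inverse covariance in the `k`-th step of a sweep. -/
def invStep (S T : Blocks d) (k : ℕ) : ℝ :=
  frob ((covariance H (partialUpdate S T (k + 1)))⁻¹ - (covariance H (partialUpdate S T k))⁻¹)

lemma sum_trace_partialUpdate_succ (S T : Blocks d) (k : Fin K) :
    ∑ j, (partialUpdate S T (k + 1) j).trace.re =
      ∑ j, (partialUpdate S T k j).trace.re + (T k - S k).trace.re := by
  rw [← Finset.sum_erase_add _ _ (Finset.mem_univ k),
    ← Finset.sum_erase_add _ _ (Finset.mem_univ k), partialUpdate_succ_self, partialUpdate_self,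
    Finset.sum_congr rfl fun j hj => by
      rw [partialUpdate_succ_of_ne S T (Finset.ne_of_mem_erase hj)], trace_sub, Complex.sub_re]
  ring

variable {H} {μ : ℝ} {S T : Blocks d}

lemma IsSweep.mem_psdBlocks (h : IsSweep H μ S T) : T ∈ psdBlocks d := fun k => (h k).posSemidef

/-- First-order optimality of the updated block. -/
lemma IsSweep.re_trace_gradient_mul_le (hμ : 0 < μ) (hS : S ∈ psdBlocks d) (h : IsSweep H μ S T)
    (k : Fin K) {U : Matrix (Fin (d k)) (Fin (d k)) ℂ} (hU : U.PosSemidef) :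
    (H k * (covariance H (partialUpdate S T (k + 1)))⁻¹ * (H k)ᴴ * (U - T k)).trace.re ≤
      μ * (U - T k).trace.re := by
  rw [covariance_partialUpdate_succ]
  exact (h k).re_trace_gradient_mul_le hμ
    (posDef_hBar H (partialUpdate_mem hS h.mem_psdBlocks k) k) hU

/-- The ascent of one block update. -/
lemma IsSweep.invStep_sq_le (P : ℝ) (hμ : 0 < μ) (hS : S ∈ psdBlocks d) (h : IsSweep H μ S T)
    (k : Fin K) :
    invStep H S T k ^ 2 / 2 ≤ lagrangian H P μ (partialUpdate S T (k + 1)) -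
      lagrangian H P μ (partialUpdate S T k) := by
  have hT := h.mem_psdBlocks
  have h1 := frob_sq_inv_sub_inv_le
    (posSemidef_covariance_sub_one H (partialUpdate_mem hS hT k))
    (posSemidef_covariance_sub_one H (partialUpdate_mem hS hT (k + 1)))
  have h2 := h.re_trace_gradient_mul_le hμ hS k (hS k)
  have hdiff : covariance H (partialUpdate S T (k + 1)) - covariance H (partialUpdate S T k) =
      -((H k)ᴴ * (S k - T k) * H k) := by
    rw [covariance_partialUpdate, covariance_partialUpdate_succ, Matrix.mul_sub, Matrix.sub_mul]
    abel
  set X := covariance H (partialUpdate S T (k + 1))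
  have htr : (X⁻¹ * (X - covariance H (partialUpdate S T k))).trace.re =
      -(H k * X⁻¹ * (H k)ᴴ * (S k - T k)).trace.re := by
    rw [hdiff, Matrix.mul_neg, trace_neg, Complex.neg_re, ← Matrix.mul_assoc, trace_mul_comm]
    simp only [Matrix.mul_assoc]
  rw [htr] at h1
  rw [lagrangian_eq, lagrangian_eq, sum_trace_partialUpdate_succ]
  have h3 : (T k - S k).trace.re = -(S k - T k).trace.re := by
    rw [← neg_sub, trace_neg, Complex.neg_re]
  rw [h3]
  unfold invStep
  linarith

lemma IsSweep.sum_invStep_sq_le (P : ℝ) (hμ : 0 < μ) (hS : S ∈ psdBlocks d)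
    (h : IsSweep H μ S T) :
    (∑ k ∈ Finset.range K, invStep H S T k ^ 2) / 2 ≤
      lagrangian H P μ T - lagrangian H P μ S := by
  have htel := Finset.sum_range_sub (fun k => lagrangian H P μ (partialUpdate S T k)) K
  rw [partialUpdate_last, partialUpdate_zero] at htel
  rw [← htel, Finset.sum_div]
  refine Finset.sum_le_sum fun k hk => ?_
  exact h.invStep_sq_le P hμ hS ⟨k, Finset.mem_range.mp hk⟩

lemma IsSweep.le_lagrangian (P : ℝ) (hμ : 0 < μ) (hS : S ∈ psdBlocks d) (h : IsSweep H μ S T) :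
    lagrangian H P μ S ≤ lagrangian H P μ T := by
  have h1 := h.sum_invStep_sq_le P hμ hS
  have h2 : 0 ≤ ∑ k ∈ Finset.range K, invStep H S T k ^ 2 :=
    Finset.sum_nonneg fun _ _ => sq_nonneg _
  linarith

lemma invStep_le (hS : S ∈ psdBlocks d) (hT : T ∈ psdBlocks d) (k : Fin K) :
    invStep H S T k ≤ √(lipConst H) * frob (T k - S k) := by
  have hdiff : covariance H (partialUpdate S T (k + 1)) - covariance H (partialUpdate S T k) =
      (H k)ᴴ * (T k - S k) * H k := by
    rw [covariance_partialUpdate, covariance_partialUpdate_succ, Matrix.mul_sub, Matrix.sub_mul]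
    abel
  calc invStep H S T k ≤ frob ((H k)ᴴ * (T k - S k) * H k) := by
        rw [← hdiff]
        exact frob_inv_sub_inv_le
          (posSemidef_covariance_sub_one H (partialUpdate_mem hS hT k))
          (posSemidef_covariance_sub_one H (partialUpdate_mem hS hT (k + 1)))
    _ ≤ lamMax (H k) * frob (T k - S k) :=
        frob_conjTranspose_mul_mul_le _ ((hT k).isHermitian.sub (hS k).isHermitian)
    _ ≤ _ := mul_le_mul_of_nonneg_right (lamMax_le_sqrt_lipConst H k) (frob_nonneg _)

/-- Used for the first sweep only, where no earlier gap bound is available to control the steps. -/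
lemma sum_invStep_sq_le_lipConst_mul (hS : S ∈ psdBlocks d) (hT : T ∈ psdBlocks d) :
    ∑ k ∈ Finset.range K, invStep H S T k ^ 2 ≤ lipConst H * ∑ k, frob (T k - S k) ^ 2 := by
  rw [← Fin.sum_univ_eq_sum_range (fun k => invStep H S T k ^ 2), Finset.mul_sum]
  refine Finset.sum_le_sum fun k _ => ?_
  have := pow_le_pow_left₀ (frob_nonneg _) (invStep_le (H := H) hS hT k) 2
  rwa [mul_pow, Real.sq_sqrt (lipConst_nonneg H)] at this

/-- The suboptimality after a sweep is controlled by the steps that follow each block update. -/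
lemma IsSweep.lagrangian_sub_le (P : ℝ) (hμ : 0 < μ) (hS : S ∈ psdBlocks d)
    (h : IsSweep H μ S T) {U : Blocks d} (hU : U ∈ psdBlocks d) :
    lagrangian H P μ U - lagrangian H P μ T ≤
      √(lipConst H) * ∑ k : Fin K,
        (∑ j ∈ Finset.Ico ((k : ℕ) + 1) K, invStep H S T j) * frob (U k - T k) := by
  have hT := h.mem_psdBlocks
  refine (MacSumRate.lagrangian_sub_le H P μ hT hU).trans ?_
  rw [Finset.mul_sum]
  refine Finset.sum_le_sum fun k _ => ?_
  have hopt := h.re_trace_gradient_mul_le hμ hS k (hU k)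
  set Y : ℕ → Matrix (Fin N) (Fin N) ℂ := fun j => (covariance H (partialUpdate S T j))⁻¹ with hY
  have hYK : (covariance H T)⁻¹ = Y K := by simp only [hY, partialUpdate_last]
  have hYh : ∀ j, (Y j).IsHermitian := fun j =>
    (posDef_of_sub_one (posSemidef_covariance_sub_one H
      (partialUpdate_mem hS hT j))).inv.isHermitian
  rw [hYK]
  change (H k * Y (k + 1) * (H k)ᴴ * (U k - T k)).trace.re ≤ _ at hopt
  have hfr : frob (Y K - Y (k + 1)) ≤ ∑ j ∈ Finset.Ico ((k : ℕ) + 1) K, invStep H S T j := by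
    rw [← Finset.sum_Ico_sub Y (Nat.succ_le_of_lt k.isLt)]
    exact frob_sum_le _ _
  -- The gradient at the end of the sweep is compared with the one right after the update of block
  -- `k`, where `hopt` applies.
  have hsplit : (H k * Y K * (H k)ᴴ * (U k - T k)).trace.re =
      (H k * Y (k + 1) * (H k)ᴴ * (U k - T k)).trace.re +
        (H k * (Y K - Y (k + 1)) * (H k)ᴴ * (U k - T k)).trace.re := by
    rw [← Complex.add_re, ← trace_add, ← Matrix.add_mul, ← Matrix.add_mul, ← Matrix.mul_add,
      add_sub_cancel]
  have hbound : (H k * (Y K - Y (k + 1)) * (H k)ᴴ * (U k - T k)).trace.re ≤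
      √(lipConst H) * ((∑ j ∈ Finset.Ico ((k : ℕ) + 1) K, invStep H S T j) *
        frob (U k - T k)) := by
    have hh := (hYh K).sub (hYh (k + 1))
    refine (re_trace_mul_le (isHermitian_mul_mul_conjTranspose (H k) hh)).trans ?_
    rw [← mul_assoc]
    refine mul_le_mul_of_nonneg_right ?_ (frob_nonneg _)
    refine (frob_mul_mul_conjTranspose_le (H k) hh).trans ?_
    exact mul_le_mul (lamMax_le_sqrt_lipConst H k) hfr (frob_nonneg _) (Real.sqrt_nonneg _)
  linarith

lemma sum_range_sub_natCast (c : ℝ) (n : ℕ) :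
    ∑ k ∈ Finset.range n, (c - k) = n * c - n * (n - 1) / 2 := by
  induction n with
  | zero => simp
  | succ n ih => rw [Finset.sum_range_succ, ih]; push_cast; ring

/-- Cauchy-Schwarz for the sums of the tails of a sequence. -/
lemma sq_sum_tail_mul_le (δ : ℕ → ℝ) (a : Fin K → ℝ) :
    (∑ k : Fin K, (∑ j ∈ Finset.Ico ((k : ℕ) + 1) K, δ j) * a k) ^ 2 ≤
      (K * (K - 1) / 2 : ℝ) * (∑ j ∈ Finset.range K, δ j ^ 2) * ∑ k, a k ^ 2 := by
  refine (Finset.sum_mul_sq_le_sq_mul_sq _ _ _).trans ?_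
  refine mul_le_mul_of_nonneg_right ?_ (Finset.sum_nonneg fun _ _ => sq_nonneg _)
  -- The tail after block `k` has `K - 1 - k` terms; leaving out step `k` itself yields the factor
  -- `K - 1` of the recursion.
  have hc : (K * (K - 1) / 2 : ℝ) = ∑ k ∈ Finset.range K, (((K : ℝ) - 1) - k) := by
    rw [sum_range_sub_natCast]; ring
  rw [hc, ← Fin.sum_univ_eq_sum_range (fun k => ((K : ℝ) - 1) - k), Finset.sum_mul]
  refine Finset.sum_le_sum fun k _ => ?_
  refine (sq_sum_le_card_mul_sum_sq).trans ?_
  have hcard : ((Finset.Ico ((k : ℕ) + 1) K).card : ℝ) = (K : ℝ) - 1 - (k : ℕ) := by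
    rw [Nat.card_Ico, Nat.cast_sub (Nat.succ_le_of_lt k.isLt)]
    push_cast; ring
  rw [← hcard]
  refine mul_le_mul_of_nonneg_left ?_ (Nat.cast_nonneg _)
  refine Finset.sum_le_sum_of_subset_of_nonneg ?_ fun _ _ _ => sq_nonneg _
  intro j hj
  simp only [Finset.mem_Ico, Finset.mem_range] at hj ⊢
  exact hj.2

lemma IsSweep.sq_lagrangian_sub_le (P : ℝ) (hμ : 0 < μ) (hS : S ∈ psdBlocks d)
    (h : IsSweep H μ S T) {U : Blocks d} (hU : U ∈ psdBlocks d)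
    (hle : lagrangian H P μ T ≤ lagrangian H P μ U) :
    (lagrangian H P μ U - lagrangian H P μ T) ^ 2 ≤
      lipConst H * ((K * (K - 1) / 2 : ℝ) * (∑ j ∈ Finset.range K, invStep H S T j ^ 2) *
        ∑ k, frob (U k - T k) ^ 2) := by
  refine (pow_le_pow_left₀ (sub_nonneg.mpr hle) (h.lagrangian_sub_le P hμ hS hU) 2).trans ?_
  rw [mul_pow, Real.sq_sqrt (lipConst_nonneg H)]
  exact mul_le_mul_of_nonneg_left (sq_sum_tail_mul_le _ _) (lipConst_nonneg H)

end Sweep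

/-! ### The Frobenius distance of tuples -/

section Distance

/-- All entries of a tuple of matrices as a vector of the Euclidean space. -/
def blockEntries (S : Blocks d) : EuclideanSpace ℂ ((k : Fin K) × Fin (d k) × Fin (d k)) :=
  WithLp.toLp 2 fun p => S p.1 p.2.1 p.2.2

lemma frobDist_eq_dist (S T : Blocks d) :
    frobDist S T = dist (blockEntries S) (blockEntries T) := by
  rw [EuclideanSpace.dist_eq, frobDist, Fintype.sum_sigma]
  simp [blockEntries, Fintype.sum_prod_type, dist_eq_norm]

lemma frobDist_nonneg (S T : Blocks d) : 0 ≤ frobDist S T := Real.sqrt_nonneg _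

lemma frobDist_comm (S T : Blocks d) : frobDist S T = frobDist T S := by
  simp only [frobDist_eq_dist, dist_comm]

lemma frobDist_triangle (S T U : Blocks d) : frobDist S U ≤ frobDist S T + frobDist T U := by
  simp only [frobDist_eq_dist]
  exact dist_triangle _ _ _

lemma sum_frob_sub_sq (S T : Blocks d) : ∑ k, frob (S k - T k) ^ 2 = frobDist S T ^ 2 := by
  rw [frobDist, Real.sq_sqrt (by positivity)]
  simp only [frob_sq, Matrix.sub_apply]

lemma continuous_frobDist (T : Blocks d) : Continuous fun S : Blocks d => frobDist S T := by
  unfold frobDist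
  fun_prop

end Distance

/-! ### Coercivity and existence of the maxima -/

section Compactness

lemma norm_apply_le_frob {m n : Type*} [Fintype m] [Fintype n] (A : Matrix m n ℂ) (i : m)
    (j : n) : ‖A i j‖ ≤ frob A := by
  rw [← norm_entries]
  exact PiLp.norm_apply_le (entries A) (i, j)

/-- No eigenvalue exceeds the trace, so `A ≤ tr A • 1` and `tr A² ≤ (tr A)²`. -/
lemma frob_le_re_trace {n : Type*} [Fintype n] [DecidableEq n] {A : Matrix n n ℂ}
    (hA : A.PosSemidef) : frob A ≤ A.trace.re := by
  have htr : A.trace.re = ∑ i, hA.isHermitian.eigenvalues i := by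
    rw [hA.isHermitian.trace_eq_sum_eigenvalues]
    simp
  have h0 : 0 ≤ A.trace.re := (Complex.nonneg_iff.mp hA.trace_nonneg).1
  have hle := posSemidef_smul_one_sub hA.isHermitian (l := A.trace.re) fun i => by
    rw [htr]
    exact Finset.single_le_sum (fun j _ => hA.eigenvalues_nonneg j) (Finset.mem_univ i)
  refine le_of_sq_le_sq ?_ h0
  have := re_trace_mul_le_mul hA hle
  rw [Matrix.mul_smul, trace_smul, Matrix.mul_one, smul_eq_mul, Complex.re_ofReal_mul] at this
  rw [frob_sq_eq_trace, hA.isHermitian.eq, sq]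
  exact this

lemma isClosed_posSemidef {n : Type*} [Fintype n] :
    IsClosed {A : Matrix n n ℂ | A.PosSemidef} := by
  simp only [posSemidef_iff_dotProduct_mulVec, Set.ofPred_and, Set.ofPred_forall]
  refine IsClosed.inter ?_ (isClosed_iInter fun x => ?_)
  · exact isClosed_eq (by fun_prop) continuous_id
  · exact isClosed_le continuous_const
      (continuous_const.dotProduct (continuous_id.matrix_mulVec continuous_const))

lemma isClosed_psdBlocks : IsClosed (psdBlocks d) := by
  simp only [psdBlocks, Set.ofPred_forall]
  refine isClosed_iInter fun k => ?_
  have hk : Continuous fun S : Blocks d => S k := continuous_apply k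
  exact isClosed_posSemidef.preimage hk

variable (H : (k : Fin K) → Matrix (Fin (d k)) (Fin N) ℂ)

lemma continuousOn_lagrangian (P μ : ℝ) : ContinuousOn (lagrangian H P μ) (psdBlocks d) := by
  unfold lagrangian
  refine ContinuousOn.sub (ContinuousOn.log ?_ ?_) ?_
  · exact Continuous.continuousOn (by fun_prop)
  · intro S hS
    exact (Complex.pos_iff.mp
      (posDef_of_sub_one (posSemidef_covariance_sub_one H hS)).det_pos).1.ne'
  · exact Continuous.continuousOn (by fun_prop)

lemma re_trace_covariance_le {S : Blocks d} (hS : S ∈ psdBlocks d) :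
    (covariance H S).trace.re ≤ N + (∑ k, lamMax (H k)) * ∑ k, (S k).trace.re := by
  have h0 : ∀ k, 0 ≤ (S k).trace.re := fun k =>
    (Complex.nonneg_iff.mp (hS k).trace_nonneg).1
  rw [covariance, trace_add, trace_one, trace_sum, Complex.add_re, Complex.re_sum]
  simp only [Fintype.card_fin, Complex.natCast_re]
  gcongr
  rw [Finset.sum_mul]
  refine Finset.sum_le_sum fun k _ => ?_
  calc ((H k)ᴴ * S k * H k).trace.re = (S k * (H k * (H k)ᴴ)).trace.re := by
        rw [Matrix.mul_assoc, trace_mul_comm, Matrix.mul_assoc]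
    _ ≤ lamMax (H k) * (S k).trace.re := re_trace_mul_mul_conjTranspose_le _ (hS k)
    _ ≤ _ := mul_le_mul_of_nonneg_left
        (Finset.single_le_sum (fun j _ => h0 j) (Finset.mem_univ k)) (lamMax_nonneg _)

/-- The Lagrangian is coercive on the feasible set. -/
lemma exists_lagrangian_le_sub_mul (P : ℝ) {μ : ℝ} (hμ : 0 < μ) :
    ∃ C : ℝ, ∀ S ∈ psdBlocks d, lagrangian H P μ S ≤ C - μ / 2 * ∑ k, (S k).trace.re := by
  set l := ∑ k, lamMax (H k)
  -- `log det` is bounded by its tangent at `a • 1`. Large `a` makes the slope `l / a` at most half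
  -- the penalty `μ`; `a ≥ 1` keeps the base point above `1`.
  set a : ℝ := max 1 (2 * l / μ)
  have ha1 : 1 ≤ a := le_max_left _ _
  have ha0 : 0 < a := by linarith
  have hal : l / a ≤ μ / 2 := by
    rw [div_le_div_iff₀ ha0 two_pos]
    have : 2 * l / μ ≤ a := le_max_right _ _
    rw [div_le_iff₀ hμ] at this
    linarith
  set A : Matrix (Fin N) (Fin N) ℂ := (a : ℂ) • 1
  have hA1 : (A - 1).PosSemidef := by
    have h1 : (0 : ℂ) ≤ ((a - 1 : ℝ) : ℂ) := by exact_mod_cast sub_nonneg.mpr ha1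
    convert (PosSemidef.one (n := Fin N) (R := ℂ)).smul h1 using 1
    simp [A, sub_smul]
  have hAinv : A⁻¹ = ((a⁻¹ : ℝ) : ℂ) • 1 := by
    refine Matrix.inv_eq_left_inv ?_
    rw [Matrix.smul_mul, Matrix.one_mul, smul_smul, ← Complex.ofReal_mul, inv_mul_cancel₀ ha0.ne']
    simp
  refine ⟨Real.log A.det.re + μ * P, fun S hS => ?_⟩
  have hlog := log_det_sub_le (posSemidef_covariance_sub_one H hS) hA1
  have hτ : 0 ≤ ∑ k, (S k).trace.re := Finset.sum_nonneg fun k _ =>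
    (Complex.nonneg_iff.mp (hS k).trace_nonneg).1
  have htr : (A⁻¹ * (covariance H S - A)).trace.re = (covariance H S).trace.re / a - N := by
    rw [hAinv, Matrix.smul_mul, Matrix.one_mul, trace_smul, trace_sub, trace_smul, trace_one,
      smul_eq_mul, smul_eq_mul, Complex.re_ofReal_mul, Complex.sub_re, Complex.re_ofReal_mul]
    simp only [Fintype.card_fin, Complex.natCast_re]
    field_simp
  have hbound : (covariance H S).trace.re / a - N ≤ μ / 2 * ∑ k, (S k).trace.re := by
    calc (covariance H S).trace.re / a - N
        ≤ (N + l * ∑ k, (S k).trace.re) / a - N := by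
          gcongr
          exact re_trace_covariance_le H hS
      _ = N / a - N + l / a * ∑ k, (S k).trace.re := by ring
      _ ≤ 0 + μ / 2 * ∑ k, (S k).trace.re := by
          gcongr
          exact sub_nonpos.mpr (div_le_self (Nat.cast_nonneg N) ha1)
      _ = _ := zero_add _
  rw [lagrangian_eq]
  linarith

lemma isCompact_setOf_norm_apply_le (C : ℝ) :
    IsCompact {S : Blocks d | ∀ k i j, ‖S k i j‖ ≤ C} := by
  have h : {S : Blocks d | ∀ k i j, ‖S k i j‖ ≤ C} =
      Set.univ.pi fun k : Fin K => Set.univ.pi fun _ : Fin (d k) =>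
        Set.univ.pi fun _ : Fin (d k) => Metric.closedBall (0 : ℂ) C := by
    ext S
    exact ⟨fun h k _ i _ j _ => mem_closedBall_zero_iff.mpr (h k i j),
      fun h k i j => mem_closedBall_zero_iff.mp (h k trivial i trivial j trivial)⟩
  rw [h]
  exact isCompact_univ_pi fun k => isCompact_univ_pi fun i => isCompact_univ_pi fun j =>
    isCompact_closedBall 0 C

/-- The superlevel sets of the Lagrangian are compact. -/
lemma isCompact_superlevel (P : ℝ) {μ : ℝ} (hμ : 0 < μ) (t : ℝ) :
    IsCompact {S ∈ psdBlocks d | t ≤ lagrangian H P μ S} := by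
  obtain ⟨C, hC⟩ := exists_lagrangian_le_sub_mul H P hμ
  refine (isCompact_setOf_norm_apply_le (d := d) ((C - t) / (μ / 2))).of_isClosed_subset ?_ ?_
  · exact (continuousOn_lagrangian H P μ).preimage_isClosed_of_isClosed isClosed_psdBlocks
      isClosed_Ici
  · rintro S ⟨hS, ht⟩ k i j
    have h1 := hC S hS
    have h2 : (S k).trace.re ≤ ∑ k, (S k).trace.re := Finset.single_le_sum
      (f := fun k => (S k).trace.re)
      (fun k _ => (Complex.nonneg_iff.mp (hS k).trace_nonneg).1) (Finset.mem_univ k)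
    refine ((norm_apply_le_frob (S k) i j).trans (frob_le_re_trace (hS k))).trans (h2.trans ?_)
    rw [le_div_iff₀ (by positivity)]
    linarith

/-- A maximizer on the compact superlevel set of `S₀` also beats every feasible point outside it. -/
lemma isGreatest_optValue (P : ℝ) {μ : ℝ} (hμ : 0 < μ) {S₀ : Blocks d} (hS₀ : S₀ ∈ psdBlocks d) :
    IsGreatest (lagrangianValues H P μ) (optValue H P μ) := by
  have hcomp := isCompact_superlevel H P hμ (lagrangian H P μ S₀)
  obtain ⟨U, hU, hmax⟩ := hcomp.exists_isMaxOn ⟨S₀, hS₀, le_rfl⟩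
    ((continuousOn_lagrangian H P μ).mono fun S hS => hS.1)
  have hg : IsGreatest (lagrangianValues H P μ) (lagrangian H P μ U) := by
    refine ⟨⟨U, hU.1, rfl⟩, ?_⟩
    rintro _ ⟨S, hS, rfl⟩
    rcases le_total (lagrangian H P μ S₀) (lagrangian H P μ S) with h | h
    · exact hmax ⟨hS, h⟩
    · exact h.trans hU.2
  rw [optValue, hg.csSup_eq]
  exact hg

lemma isGreatest_levelRadius (P : ℝ) {μ : ℝ} (hμ : 0 < μ) {S₀ : Blocks d}
    (hS₀ : S₀ ∈ psdBlocks d) :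
    IsGreatest (levelDistances H P μ S₀) (levelRadius H P μ S₀) := by
  have hcomp := (isCompact_superlevel H P hμ (lagrangian H P μ S₀)).image (continuous_frobDist S₀)
  exact hcomp.isGreatest_sSup ⟨_, S₀, ⟨hS₀, le_rfl⟩, rfl⟩

end Compactness

/-! ### The recursion for the gaps and the `1 / n` rate -/

section Rate

/-- A sequence of suboptimality gaps with the quadratic recursion of the sweeps decays like
`1 / n`. -/
lemma gap_le_of_recursion {x : ℕ → ℝ} {q L : ℝ} (hL : 1 ≤ L) (hq : 0 ≤ q)
    (hx : ∀ n, 0 ≤ x n) (hinit : x 1 ≤ 4 * q * L)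
    (hrec : ∀ n, x (n + 1) ^ 2 ≤ 4 * (q * L * (L - 1)) * (x n - x (n + 1))) (n : ℕ) :
    x (n + 1) * (n + L) ≤ 4 * q * L ^ 2 := by
  induction n with
  | zero =>
    push_cast
    nlinarith
  | succ n ih =>
    -- If the bound fails for `y`, the induction hypothesis gives `(x (n + 1) - y) (n + L) < y`, and
    -- the recursion forces `y (n + L) ≤ 4 q L (L - 1)`. This is contradictory since `L² (n + L) - L
    -- (L - 1) (n + 1 + L) = L (n + 1) ≥ 0`.
    by_contra! hlt
    push_cast at hlt
    set y := x (n + 1 + 1)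
    have hr := hrec (n + 1)
    change y ^ 2 ≤ _ * (x (n + 1) - y) at hr
    have hy : 0 ≤ y := hx _
    have hn : (0 : ℝ) ≤ n := Nat.cast_nonneg n
    have hm : 0 < (n : ℝ) + L := by linarith
    have hypos : 0 < y := by
      by_contra! h0
      have : y = 0 := le_antisymm h0 hy
      rw [this] at hlt
      nlinarith [mul_nonneg hq (sq_nonneg L)]
    have hc : 0 ≤ 4 * (q * L * (L - 1)) := by
      have := sub_nonneg.mpr hL
      positivity
    have h1 : y ^ 2 * (n + L) ≤ 4 * (q * L * (L - 1)) * (4 * q * L ^ 2 - y * (n + L)) := by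
      calc y ^ 2 * (n + L) ≤ 4 * (q * L * (L - 1)) * (x (n + 1) - y) * (n + L) :=
            mul_le_mul_of_nonneg_right hr hm.le
        _ = 4 * (q * L * (L - 1)) * (x (n + 1) * (n + L) - y * (n + L)) := by ring
        _ ≤ _ := by gcongr
    have h2 : 4 * q * L ^ 2 - y * (n + L) < y := by linarith
    have h3 : y ^ 2 * (n + L) ≤ 4 * (q * L * (L - 1)) * y :=
      h1.trans (mul_le_mul_of_nonneg_left h2.le hc)
    have h4 : y * (n + L) ≤ 4 * (q * L * (L - 1)) := by
      refine le_of_mul_le_mul_left ?_ hypos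
      linarith
    have h5 : y * (n + 1 + L) * (n + L) ≤ 4 * (q * L * (L - 1)) * (n + 1 + L) := by
      nlinarith
    have h6 : 4 * q * L ^ 2 * (n + L) < y * (n + 1 + L) * (n + L) :=
      mul_lt_mul_of_pos_right hlt hm
    have h7 : 4 * (q * L * (L - 1)) * (n + 1 + L) ≤ 4 * q * L ^ 2 * (n + L) := by
      have : 0 ≤ 4 * q * L * (n + 1) := by positivity
      nlinarith
    linarith

lemma IsCBCM.mem_psdBlocks {H : (k : Fin K) → Matrix (Fin (d k)) (Fin N) ℂ} {μ : ℝ}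
    {S : ℕ → Blocks d} (hS : IsCBCM H μ S) (hS₀ : S 0 ∈ psdBlocks d) (n : ℕ) :
    S n ∈ psdBlocks d := by
  cases n with
  | zero => exact hS₀
  | succ n => exact (hS.isSweep n).mem_psdBlocks

lemma IsCBCM.monotone_lagrangian {H : (k : Fin K) → Matrix (Fin (d k)) (Fin N) ℂ} {μ : ℝ}
    {S : ℕ → Blocks d} (hS : IsCBCM H μ S) (P : ℝ) (hμ : 0 < μ) (hS₀ : S 0 ∈ psdBlocks d) :
    Monotone fun n => lagrangian H P μ (S n) :=
  monotone_nat_of_le_succ fun n => (hS.isSweep n).le_lagrangian P hμ (hS.mem_psdBlocks hS₀ n)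

/-- The suboptimality of the iterates, with an explicit constant. -/
lemma IsCBCM.gap_le {H : (k : Fin K) → Matrix (Fin (d k)) (Fin N) ℂ} {μ : ℝ}
    {S : ℕ → Blocks d} (hS : IsCBCM H μ S) (P : ℝ) (hμ : 0 < μ) (hS₀ : S 0 ∈ psdBlocks d)
    (hK : 1 ≤ K) (n : ℕ) :
    (optValue H P μ - lagrangian H P μ (S (n + 1))) * (n + K) ≤
      4 * (lipConst H * levelRadius H P μ (S 0) ^ 2) * (K : ℝ) ^ 2 := by
  set R := levelRadius H P μ (S 0)
  have hopt := isGreatest_optValue H P hμ hS₀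
  have hR := isGreatest_levelRadius H P hμ hS₀
  have hmem := hS.mem_psdBlocks hS₀
  obtain ⟨U, hU, hUopt⟩ := hopt.1
  have hdist : ∀ T ∈ psdBlocks d, lagrangian H P μ (S 0) ≤ lagrangian H P μ T →
      frobDist T (S 0) ≤ R := fun T hT hle => hR.2 ⟨T, ⟨hT, hle⟩, rfl⟩
  have hlev : ∀ n, lagrangian H P μ (S 0) ≤ lagrangian H P μ (S n) := fun n =>
    hS.monotone_lagrangian P hμ hS₀ (Nat.zero_le n)
  have hleU : ∀ n, lagrangian H P μ (S n) ≤ lagrangian H P μ U := fun n => by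
    rw [hUopt]; exact hopt.2 ⟨S n, hmem n, rfl⟩
  have hUR := hdist U hU (hleU 0)
  have hR0 : 0 ≤ R := (frobDist_nonneg _ _).trans hUR
  have hUS : ∀ n, frobDist U (S n) ^ 2 ≤ 4 * R ^ 2 := fun n => by
    have h1 := frobDist_triangle U (S 0) (S n)
    rw [frobDist_comm (S 0)] at h1
    have h2 := hdist (S n) (hmem n) (hlev n)
    have h3 := pow_le_pow_left₀ (frobDist_nonneg _ _) (h1.trans (add_le_add hUR h2)) 2
    linarith
  have hM := lipConst_nonneg H
  have hL : (1 : ℝ) ≤ K := by exact_mod_cast hK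
  have hKK : (0 : ℝ) ≤ K * (K - 1) / 2 := by
    have := sub_nonneg.mpr hL
    positivity
  -- `Q` is left free for two uses: `M R²` for the initial gap, and twice the ascent for the
  -- recursion.
  have hsq : ∀ n, ∀ Q : ℝ, ∑ j ∈ Finset.range K, invStep H (S n) (S (n + 1)) j ^ 2 ≤ Q →
      (lagrangian H P μ U - lagrangian H P μ (S (n + 1))) ^ 2 ≤
        lipConst H * ((K * (K - 1) / 2 : ℝ) * Q * (4 * R ^ 2)) := by
    intro n Q hQ
    have h0 : 0 ≤ ∑ j ∈ Finset.range K, invStep H (S n) (S (n + 1)) j ^ 2 :=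
      Finset.sum_nonneg fun _ _ => sq_nonneg _
    refine ((hS.isSweep n).sq_lagrangian_sub_le P hμ (hmem n) hU (hleU _)).trans ?_
    rw [sum_frob_sub_sq]
    have := hUS (n + 1)
    have := h0.trans hQ
    gcongr
  rw [← hUopt]
  refine gap_le_of_recursion (x := fun n => lagrangian H P μ U - lagrangian H P μ (S n)) hL
    (mul_nonneg hM (sq_nonneg R)) (fun n => sub_nonneg.mpr (hleU n)) ?_ (fun n => ?_) n
  · have h1 := sum_invStep_sq_le_lipConst_mul (H := H) (hmem 0) (hmem 1)
    rw [sum_frob_sub_sq] at h1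
    have h2 : frobDist (S 1) (S 0) ^ 2 ≤ R ^ 2 :=
      pow_le_pow_left₀ (frobDist_nonneg _ _) (hdist (S 1) (hmem 1) (hlev 1)) 2
    have h3 := hsq 0 (lipConst H * R ^ 2) (h1.trans (mul_le_mul_of_nonneg_left h2 hM))
    -- With `q = M R²`, `h3` bounds the squared first gap by `2 q² K (K - 1)`, well below `(4 q
    -- K)²`.
    refine le_of_sq_le_sq (h3.trans ?_) (by positivity)
    have h4 : 0 ≤ (lipConst H * R ^ 2) ^ 2 * K := by positivity
    nlinarith
  · have h1 := (hS.isSweep n).sum_invStep_sq_le P hμ (hmem n)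
    refine (hsq n (2 * (lagrangian H P μ (S (n + 1)) - lagrangian H P μ (S n)))
      (by linarith)).trans_eq ?_
    ring

end Rate

end MacSumRate

end

theorem theorem1 {K N : ℕ} {d : Fin K → ℕ}
    (H : (k : Fin K) → Matrix (Fin (d k)) (Fin N) ℂ) (P μ : ℝ) (hμ : 0 < μ)
    (S : ℕ → MacSumRate.Blocks d) (hS₀ : S 0 ∈ MacSumRate.psdBlocks d)
    (hS : MacSumRate.IsCBCM H μ S) :
    -- the two maxima in the statement exist
    IsGreatest (MacSumRate.lagrangianValues H P μ) (MacSumRate.optValue H P μ) ∧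
    IsGreatest (MacSumRate.levelDistances H P μ (S 0)) (MacSumRate.levelRadius H P μ (S 0)) ∧
    ∀ n : ℕ, 1 ≤ n →
      MacSumRate.optValue H P μ - MacSumRate.lagrangian H P μ (S n) ≤
        2 * MacSumRate.rateConst (MacSumRate.lipConst H) K (MacSumRate.levelRadius H P μ (S 0))
              (MacSumRate.optValue H P μ - MacSumRate.lagrangian H P μ (S 1)) *
          MacSumRate.lipConst H * (K : ℝ) ^ 2 *
          MacSumRate.levelRadius H P μ (S 0) ^ 2 * (1 / (n : ℝ)) := by
  refine ⟨MacSumRate.isGreatest_optValue H P hμ hS₀,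
    MacSumRate.isGreatest_levelRadius H P hμ hS₀, fun n hn => ?_⟩
  set c := MacSumRate.rateConst (MacSumRate.lipConst H) K (MacSumRate.levelRadius H P μ (S 0))
    (MacSumRate.optValue H P μ - MacSumRate.lagrangian H P μ (S 1))
  -- The entry `2` of the maximum suffices, since the constant of `IsCBCM.gap_le` is `4 = 2 * 2`.
  have hc : 2 ≤ c := (le_max_right _ _).trans (le_max_left _ _)
  have hM := MacSumRate.lipConst_nonneg H
  set R := MacSumRate.levelRadius H P μ (S 0)
  have hn0 : (0 : ℝ) < n := by exact_mod_cast hn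
  -- Without blocks there is a single tuple, so the gap is zero.
  rcases Nat.eq_zero_or_pos K with rfl | hK
  · obtain ⟨U, -, hU⟩ := (MacSumRate.isGreatest_optValue H P hμ hS₀).1
    rw [← hU, Subsingleton.elim U (S n)]
    simp
  obtain ⟨m, rfl⟩ : ∃ m, n = m + 1 := ⟨n - 1, by omega⟩
  have hgap := hS.gap_le P hμ hS₀ hK m
  have hopt : 0 ≤ MacSumRate.optValue H P μ - MacSumRate.lagrangian H P μ (S (m + 1)) :=
    sub_nonneg.mpr ((MacSumRate.isGreatest_optValue H P hμ hS₀).2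
      ⟨_, hS.mem_psdBlocks hS₀ (m + 1), rfl⟩)
  have hL : (1 : ℝ) ≤ K := by exact_mod_cast hK
  rw [mul_one_div, le_div_iff₀ hn0]
  calc _ ≤ (MacSumRate.optValue H P μ - MacSumRate.lagrangian H P μ (S (m + 1))) * (m + K) := by
        push_cast
        gcongr
    _ ≤ 4 * (MacSumRate.lipConst H * R ^ 2) * (K : ℝ) ^ 2 := hgap
    _ = 2 * 2 * (MacSumRate.lipConst H * (K : ℝ) ^ 2 * R ^ 2) := by ring
    _ ≤ 2 * c * (MacSumRate.lipConst H * (K : ℝ) ^ 2 * R ^ 2) := by gcongr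
    _ = _ := by ring
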